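/- Let $N\ge 3$ and let $\Omega\subset\mathbb{R}^N$ be a bounded domain (nonempty, open, connected), with no regularity assumption on $\partial\Omega$. Let $P(\partial\Omega)$ be the set of Borel probability measures on $\mathbb{R}^N$ supported on $\partial\Omega$, and let $$\mathcal X=\{\phi\in D^{1,2}(\mathbb{R}^N):\ \phi \text{ is Lipschitz},\ \|\nabla\phi\|_\infty\le 1\},$$ where $D^{1,2}(\mathbb{R}^N)$ is the completion of $C_c^\infty(\mathbb{R}^N)$ with respect to the norm $\|\nabla\cdot\|_{L^2}$, realized as a space of functions in $L^{2N/(N-2)}(\mathbb{R}^N)$. For $\rho\in P(\partial\Omega)$ and $\phi\in\mathcal X$ put $$I_\rho(\phi)=\int_{\mathbb{R}^N}\Bigl(1-\sqrt{1-|\nabla\phi|^2}\Bigr)\,dx-\int_{\partial\Omega}\phi\,d\rho .$$ For every $\rho\in P(\partial\Omega)$ there is a unique minimizer $\phi_\rho$ of $I_\rho$ on $\mathcal X$; its Born–Infeld energy is $\mathcal E(\phi_\rho):=-I_\rho(\phi_\rho)$. Moreover there exists an equilibrium measure, that is, a measure $\rho^*\in P(\partial\Omega)$ such that $$\mathcal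 E(\phi_{\rho^*})=\min_{\rho\in P(\partial\Omega)}\mathcal E(\phi_\rho).$$ -/

import Mathlib

open MeasureTheory Filter Topology
open scoped ENNReal ContDiff

noncomputable section

namespace BornInfeld

/-- The critical Sobolev exponent `2N / (N - 2)` (used for `N ≥ 3`). -/
def critExponent (N : ℕ) : ℝ≥0∞ :=
  ENNReal.ofReal (2 * (N : ℝ) / ((N : ℝ) - 2))

/-- The space `D^{1,2}(ℝ^N)`, `N ≥ 3`: the completion of `C_c^∞(ℝ^N)` for the norm `‖∇ψ‖_{L²}`.
By the Sobolev inequality this completion is realized inside `L^{2N/(N-2)}`: `u` belongs to it iff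
there are test functions `ψ_n` that converge to `u` in `L^{2N/(N-2)}` and whose gradients converge
in `L²` (the limit `G` is then the weak gradient of `u`). -/
def MemD12 {N : ℕ} (u : EuclideanSpace ℝ (Fin N) → ℝ) : Prop :=
  MemLp u (critExponent N) volume ∧
  ∃ G : EuclideanSpace ℝ (Fin N) → EuclideanSpace ℝ (Fin N), MemLp G 2 volume ∧
  ∃ ψ : ℕ → EuclideanSpace ℝ (Fin N) → ℝ,
    (∀ n, ContDiff ℝ ∞ (ψ n) ∧ HasCompactSupport (ψ n)) ∧
    Tendsto (fun n => eLpNorm (fun x => ψ n x - u x) (critExponent N) volume) atTop (𝓝 0) ∧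
    Tendsto (fun n => eLpNorm (fun x => gradient (ψ n) x - G x) 2 volume) atTop (𝓝 0)

/-- The admissible set `X = D^{1,2}(ℝ^N) ∩ {φ Lipschitz : ‖∇φ‖_∞ ≤ 1}`. On `ℝ^N` the bound
`‖∇φ‖_∞ ≤ 1` for a Lipschitz function says that its Lipschitz constant is at most `1`. -/
def admissible (N : ℕ) : Set (EuclideanSpace ℝ (Fin N) → ℝ) :=
  {φ | MemD12 φ ∧ LipschitzWith 1 φ}

/-- The Born-Infeld action `I_ρ(φ) = ∫ (1 - √(1 - |∇φ|²)) dx - ∫ φ dρ`. A function in `X` is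
Lipschitz, so its classical gradient exists almost everywhere and is its weak gradient. -/
def action {N : ℕ} (ρ : ProbabilityMeasure (EuclideanSpace ℝ (Fin N)))
    (φ : EuclideanSpace ℝ (Fin N) → ℝ) : ℝ :=
  (∫ x, (1 - Real.sqrt (1 - ‖gradient φ x‖ ^ 2))) -
    ∫ x, φ x ∂(ρ : Measure (EuclideanSpace ℝ (Fin N)))

/-- The Born-Infeld electrostatic energy `E(φ) = - I_ρ(φ)`. -/
def energy {N : ℕ} (ρ : ProbabilityMeasure (EuclideanSpace ℝ (Fin N)))
    (φ : EuclideanSpace ℝ (Fin N) → ℝ) : ℝ :=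
  - action ρ φ

/-- `φ` is an electrostatic potential `φ_ρ` of `ρ`: it minimizes `I_ρ` on `X`. -/
def IsPotential {N : ℕ} (ρ : ProbabilityMeasure (EuclideanSpace ℝ (Fin N)))
    (φ : EuclideanSpace ℝ (Fin N) → ℝ) : Prop :=
  φ ∈ admissible N ∧ ∀ ψ ∈ admissible N, action ρ φ ≤ action ρ ψ

/-- `P(∂Ω)`: the Borel probability measures on `ℝ^N` supported on the (closed) set `∂Ω`. -/
def boundaryMeasures {N : ℕ} (Ω : Set (EuclideanSpace ℝ (Fin N))) :
    Set (ProbabilityMeasure (EuclideanSpace ℝ (Fin N))) :=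
  {ρ | (ρ : Measure (EuclideanSpace ℝ (Fin N))) (frontier Ω)ᶜ = 0}

/-- `ρ'` is an equilibrium measure: `ρ' ∈ P(∂Ω)`, it has a potential `φ_{ρ'}`, and
`E(φ_{ρ'}) ≤ E(φ_ρ)` for all `ρ ∈ P(∂Ω)`. (Existence and uniqueness of `φ_ρ` for every
`ρ ∈ P(∂Ω)` are not built into this definition; they are to be stated next to it.) -/
def IsEquilibriumMeasure {N : ℕ} (Ω : Set (EuclideanSpace ℝ (Fin N)))
    (ρ' : ProbabilityMeasure (EuclideanSpace ℝ (Fin N))) : Prop :=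
  ρ' ∈ boundaryMeasures Ω ∧
  ∃ φ', IsPotential ρ' φ' ∧
    ∀ ρ ∈ boundaryMeasures Ω, ∀ φ, IsPotential ρ φ → energy ρ' φ' ≤ energy ρ φ

end BornInfeld

end

/-! Existence and uniqueness of the potential hold for every probability measure and come from
uniform convexity. The density satisfies a midpoint inequality with gain `‖(p - q) / 2‖ ^ 2 / 2`
(`density_midpoint_add_le`), which integrates to `action_midpoint_add_le`. So two minimizers have
zero Dirichlet distance, and a minimizing sequence is Cauchy in the Dirichlet norm. The set `X` is
complete (`exists_admissible_limit`), and Fatou's lemma shows that the limit minimizes.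

The term `∫ φ dρ` is controlled by `exists_gradNorm_le_imp_abs_le`: on `X`, Dirichlet smallness
forces uniform smallness. This needs the classical gradient in `action` to be the `D^{1,2}` gradient
(`HasGradD12.gradient_ae_eq`).

The minimal energy `ρ ↦ E(φ_ρ)` is a supremum of the weakly continuous maps `ρ ↦ -I_ρ(φ)`, hence
lower semicontinuous, and attains its minimum on the weakly compact set `P(∂Ω)`. -/

noncomputable section

namespace BornInfeld

variable {N : ℕ}

/-! ### The space `D^{1,2}` and the Sobolev inequality. -/

/-- `u` has `D^{1,2}`-gradient `G`: the pair `(u, G)` is a limit of pairs `(ψ, ∇ψ)`, `ψ` a test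
function, in `L^{2N/(N-2)} × L²`. -/
def HasGradD12 (u : EuclideanSpace ℝ (Fin N) → ℝ)
    (G : EuclideanSpace ℝ (Fin N) → EuclideanSpace ℝ (Fin N)) : Prop :=
  MemLp u (critExponent N) volume ∧ MemLp G 2 volume ∧
  ∃ ψ : ℕ → EuclideanSpace ℝ (Fin N) → ℝ,
    (∀ n, ContDiff ℝ ∞ (ψ n) ∧ HasCompactSupport (ψ n)) ∧
    Tendsto (fun n => eLpNorm (fun x => ψ n x - u x) (critExponent N) volume) atTop (𝓝 0) ∧
    Tendsto (fun n => eLpNorm (fun x => gradient (ψ n) x - G x) 2 volume) atTop (𝓝 0)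

theorem memD12_iff {u : EuclideanSpace ℝ (Fin N) → ℝ} :
    MemD12 u ↔ ∃ G, HasGradD12 u G := by
  constructor
  · rintro ⟨h1, G, h2, h3⟩
    exact ⟨G, h1, h2, h3⟩
  · rintro ⟨G, h1, h2, h3⟩
    exact ⟨h1, G, h2, h3⟩

theorem one_le_critExponent (hN : 3 ≤ N) : 1 ≤ critExponent N := by
  have h : (3 : ℝ) ≤ N := by exact_mod_cast hN
  rw [critExponent, ← ENNReal.ofReal_one]
  apply ENNReal.ofReal_le_ofReal
  rw [le_div_iff₀ (by linarith)]
  linarith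

theorem critExponent_ne_top : critExponent N ≠ ⊤ := ENNReal.ofReal_ne_top

theorem gradient_linear_comb {u v : EuclideanSpace ℝ (Fin N) → ℝ} {x : EuclideanSpace ℝ (Fin N)}
    (hu : DifferentiableAt ℝ u x) (hv : DifferentiableAt ℝ v x) (a b : ℝ) :
    gradient (fun y => a * u y + b * v y) x = a • gradient u x + b • gradient v x := by
  have h : HasFDerivAt (fun y => a * u y + b * v y) (a • fderiv ℝ u x + b • fderiv ℝ v x) x :=
    (hu.hasFDerivAt.const_mul a).add (hv.hasFDerivAt.const_mul b)
  simp [gradient, h.fderiv]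

theorem continuous_gradient {u : EuclideanSpace ℝ (Fin N) → ℝ} (hu : ContDiff ℝ ∞ u) :
    Continuous (gradient u) :=
  (InnerProductSpace.toDual ℝ _).symm.continuous.comp (hu.continuous_fderiv (by simp))

theorem norm_gradient (u : EuclideanSpace ℝ (Fin N) → ℝ) (x : EuclideanSpace ℝ (Fin N)) :
    ‖gradient u x‖ = ‖fderiv ℝ u x‖ := by
  simp [gradient]

theorem norm_gradient_le {u : EuclideanSpace ℝ (Fin N) → ℝ} (hu : LipschitzWith 1 u)
    (x : EuclideanSpace ℝ (Fin N)) : ‖gradient u x‖ ≤ 1 := by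
  rw [norm_gradient]
  simpa using norm_fderiv_le_of_lipschitz ℝ (x₀ := x) hu

theorem eLpNorm_linear_comb_le {α F : Type*} [MeasurableSpace α] {μ : Measure α}
    [NormedAddCommGroup F] [NormedSpace ℝ F] {p : ℝ≥0∞} (hp : 1 ≤ p) {f g : α → F}
    (hf : AEStronglyMeasurable f μ) (hg : AEStronglyMeasurable g μ) (a b : ℝ) :
    eLpNorm (fun x => a • f x + b • g x) p μ ≤ ‖a‖ₑ * eLpNorm f p μ + ‖b‖ₑ * eLpNorm g p μ := by
  refine (eLpNorm_add_le (hf.const_smul a) (hg.const_smul b) hp).trans ?_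
  rw [eLpNorm_const_smul, eLpNorm_const_smul]

theorem tendsto_eLpNorm_linear_comb {α F : Type*} [MeasurableSpace α] {μ : Measure α}
    [NormedAddCommGroup F] [NormedSpace ℝ F] {p : ℝ≥0∞} (hp : 1 ≤ p) {f g : ℕ → α → F}
    (hf : ∀ n, AEStronglyMeasurable (f n) μ) (hg : ∀ n, AEStronglyMeasurable (g n) μ) (a b : ℝ)
    (hf0 : Tendsto (fun n => eLpNorm (f n) p μ) atTop (𝓝 0))
    (hg0 : Tendsto (fun n => eLpNorm (g n) p μ) atTop (𝓝 0)) :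
    Tendsto (fun n => eLpNorm (fun x => a • f n x + b • g n x) p μ) atTop (𝓝 0) := by
  refine tendsto_of_tendsto_of_tendsto_of_le_of_le tendsto_const_nhds ?_ (fun n => zero_le)
    (fun n => eLpNorm_linear_comb_le hp (hf n) (hg n) a b)
  simpa using (ENNReal.Tendsto.const_mul hf0 (Or.inr enorm_ne_top)).add
    (ENNReal.Tendsto.const_mul hg0 (Or.inr enorm_ne_top))

namespace HasGradD12

variable {u v : EuclideanSpace ℝ (Fin N) → ℝ}
  {G H : EuclideanSpace ℝ (Fin N) → EuclideanSpace ℝ (Fin N)}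

theorem zero : HasGradD12 (fun _ : EuclideanSpace ℝ (Fin N) => (0 : ℝ)) (fun _ => 0) := by
  refine ⟨MemLp.zero', MemLp.zero', fun _ _ => 0, fun n => ⟨contDiff_const, HasCompactSupport.zero⟩,
    ?_, ?_⟩
  · simp
  · simp [gradient]

theorem linear_comb (hN : 3 ≤ N) (hu : HasGradD12 u G) (hv : HasGradD12 v H) (a b : ℝ) :
    HasGradD12 (fun x => a * u x + b * v x) (fun x => a • G x + b • H x) := by
  obtain ⟨hu, hG, ψ, hψ, hψu, hψG⟩ := hu
  obtain ⟨hv, hH, χ, hχ, hχv, hχH⟩ := hv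
  refine ⟨(hu.const_mul a).add (hv.const_mul b), (hG.const_smul a).add (hH.const_smul b),
    fun n x => a * ψ n x + b * χ n x, fun n => ⟨?_, ?_⟩, ?_, ?_⟩
  · exact (contDiff_const.mul (hψ n).1).add (contDiff_const.mul (hχ n).1)
  · exact ((hψ n).2.mul_left (f := fun _ => a)).add ((hχ n).2.mul_left (f := fun _ => b))
  · refine (tendsto_eLpNorm_linear_comb (one_le_critExponent hN)
      (fun n => (hψ n).1.continuous.aestronglyMeasurable.sub hu.1)
      (fun n => (hχ n).1.continuous.aestronglyMeasurable.sub hv.1) a b hψu hχv).congr fun n => ?_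
    congr 1
    ext x
    simp only [Pi.sub_apply, smul_eq_mul]
    ring
  · refine (tendsto_eLpNorm_linear_comb one_le_two
      (fun n => (continuous_gradient (hψ n).1).aestronglyMeasurable.sub hG.1)
      (fun n => (continuous_gradient (hχ n).1).aestronglyMeasurable.sub hH.1) a b hψG hχH).congr
        fun n => ?_
    congr 1
    ext1 x
    rw [gradient_linear_comb ((hψ n).1.differentiable (by simp) x)
      ((hχ n).1.differentiable (by simp) x)]
    simp only [Pi.sub_apply, smul_sub]
    abel

/-- Diagonal argument: replace each pair `(w n, K n)` by a test function within `1 / (n + 1)` in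
both norms. -/
theorem of_tendsto (hN : 3 ≤ N) {w : ℕ → EuclideanSpace ℝ (Fin N) → ℝ}
    {K : ℕ → EuclideanSpace ℝ (Fin N) → EuclideanSpace ℝ (Fin N)}
    (hw : ∀ n, HasGradD12 (w n) (K n)) (hu : MemLp u (critExponent N) volume)
    (hG : MemLp G 2 volume)
    (hwu : Tendsto (fun n => eLpNorm (fun x => w n x - u x) (critExponent N) volume) atTop (𝓝 0))
    (hKG : Tendsto (fun n => eLpNorm (fun x => K n x - G x) 2 volume) atTop (𝓝 0)) :
    HasGradD12 u G := by
  have key : ∀ n : ℕ, ∃ ψ : EuclideanSpace ℝ (Fin N) → ℝ,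
      (ContDiff ℝ ∞ ψ ∧ HasCompactSupport ψ) ∧
      eLpNorm (fun x => ψ x - w n x) (critExponent N) volume < ((n : ℝ≥0∞) + 1)⁻¹ ∧
      eLpNorm (fun x => gradient ψ x - K n x) 2 volume < ((n : ℝ≥0∞) + 1)⁻¹ := by
    intro n
    obtain ⟨-, -, ψ, hψ, h1, h2⟩ := hw n
    have hpos : (0 : ℝ≥0∞) < ((n : ℝ≥0∞) + 1)⁻¹ := by
      rw [ENNReal.inv_pos]
      exact ENNReal.add_ne_top.2 ⟨ENNReal.natCast_ne_top n, ENNReal.one_ne_top⟩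
    obtain ⟨m, hm1, hm2⟩ := ((h1.eventually_lt_const hpos).and (h2.eventually_lt_const hpos)).exists
    exact ⟨ψ m, hψ m, hm1, hm2⟩
  choose ψ hψ h1 h2 using key
  have hlim : Tendsto (fun n : ℕ => ((n : ℝ≥0∞) + 1)⁻¹) atTop (𝓝 0) := by
    simpa using (tendsto_add_atTop_iff_nat 1).2 ENNReal.tendsto_inv_nat_nhds_zero
  refine ⟨hu, hG, ψ, hψ, ?_, ?_⟩
  · refine tendsto_of_tendsto_of_tendsto_of_le_of_le tendsto_const_nhds
      (by simpa using hlim.add hwu) (fun n => zero_le) (fun n => ?_)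
    have := eLpNorm_add_le ((hψ n).1.continuous.aestronglyMeasurable.sub (hw n).1.1)
      ((hw n).1.1.sub hu.1) (one_le_critExponent hN)
    have e : ψ n - w n + (w n - u) = fun x => ψ n x - u x := by ext x; simp
    rw [e] at this
    exact this.trans (add_le_add (h1 n).le le_rfl)
  · refine tendsto_of_tendsto_of_tendsto_of_le_of_le tendsto_const_nhds
      (by simpa using hlim.add hKG) (fun n => zero_le) (fun n => ?_)
    have := eLpNorm_add_le ((continuous_gradient (hψ n).1).aestronglyMeasurable.sub (hw n).2.1.1)
      ((hw n).2.1.1.sub hG.1) (one_le_two (α := ℝ≥0∞))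
    have e : gradient (ψ n) - K n + (K n - G) = fun x => gradient (ψ n) x - G x := by
      ext1 x; simp
    rw [e] at this
    exact this.trans (add_le_add (h2 n).le le_rfl)

end HasGradD12

theorem eLpNorm_le_add_eLpNorm_sub {α F : Type*} [MeasurableSpace α] {μ : Measure α}
    [NormedAddCommGroup F] {p : ℝ≥0∞} (hp : 1 ≤ p) {f : ℕ → α → F} {g : α → F}
    (hf : ∀ n, AEStronglyMeasurable (f n) μ) (hg : AEStronglyMeasurable g μ)
    (n : ℕ) :
    eLpNorm g p μ ≤ eLpNorm (f n) p μ + eLpNorm (fun x => f n x - g x) p μ ∧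
      eLpNorm (f n) p μ ≤ eLpNorm g p μ + eLpNorm (fun x => f n x - g x) p μ := by
  constructor
  · have := eLpNorm_sub_le (hf n) ((hf n).sub hg) hp
    rwa [sub_sub_cancel] at this
  · have := eLpNorm_add_le hg ((hf n).sub hg) hp
    rwa [add_sub_cancel] at this

/-- Gagliardo–Nirenberg–Sobolev holds for test functions, and both sides pass to the limit along the
approximating sequence. -/
theorem exists_sobolev_const (hN : 3 ≤ N) :
    ∃ C : NNReal, ∀ (u : EuclideanSpace ℝ (Fin N) → ℝ)
      (G : EuclideanSpace ℝ (Fin N) → EuclideanSpace ℝ (Fin N)), HasGradD12 u G →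
      eLpNorm u (critExponent N) volume ≤ C * eLpNorm G 2 volume := by
  have hN' : (3 : ℝ) ≤ N := by exact_mod_cast hN
  set C := SNormLESNormFDerivOfEqConst ℝ
    (volume : Measure (EuclideanSpace ℝ (Fin N))) ((2 : NNReal) : ℝ)
  have htest : ∀ ψ : EuclideanSpace ℝ (Fin N) → ℝ, ContDiff ℝ ∞ ψ → HasCompactSupport ψ →
      eLpNorm ψ (critExponent N) volume ≤ C * eLpNorm (gradient ψ) 2 volume := by
    intro ψ h1 h2
    have e : eLpNorm (gradient ψ) 2 volume = eLpNorm (fderiv ℝ ψ) ((2 : NNReal) : ℝ≥0∞) volume :=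
      eLpNorm_congr_norm_ae (.of_forall fun x => norm_gradient ψ x)
    rw [e]
    refine eLpNorm_le_eLpNorm_fderiv_of_eq volume (h1.of_le (by simp)) h2
      (p' := Real.toNNReal (2 * (N : ℝ) / ((N : ℝ) - 2))) one_le_two
      (by rw [finrank_euclideanSpace_fin]; omega) ?_
    rw [Real.coe_toNNReal _ (div_nonneg (by positivity) (by linarith)), finrank_euclideanSpace_fin]
    have : (N : ℝ) ≠ 0 := by linarith
    have : (N : ℝ) - 2 ≠ 0 := by linarith
    push_cast
    field_simp
  refine ⟨C, fun u G ⟨hu, hG, ψ, hψ, h1, h2⟩ => ?_⟩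
  have hbound : ∀ n, eLpNorm u (critExponent N) volume ≤
      C * (eLpNorm G 2 volume + eLpNorm (fun x => gradient (ψ n) x - G x) 2 volume) +
        eLpNorm (fun x => ψ n x - u x) (critExponent N) volume := by
    intro n
    refine (eLpNorm_le_add_eLpNorm_sub (one_le_critExponent hN)
      (fun n => (hψ n).1.continuous.aestronglyMeasurable) hu.1 n).1.trans ?_
    gcongr
    refine (htest _ (hψ n).1 (hψ n).2).trans ?_
    gcongr
    exact (eLpNorm_le_add_eLpNorm_sub one_le_two
      (fun n => (continuous_gradient (hψ n).1).aestronglyMeasurable) hG.1 n).2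
  have hlim := ((ENNReal.Tendsto.const_mul (a := (C : ℝ≥0∞))
    ((tendsto_const_nhds (x := eLpNorm G 2 volume)).add h2)
    (Or.inr ENNReal.coe_ne_top)).add h1)
  have := ge_of_tendsto' hlim hbound
  simpa using this

/-! ### Identification of the classical gradient with the `D^{1,2}` gradient. -/

theorem tendsto_integral_mul_of_tendsto_eLpNorm {p : ℝ≥0∞} (hp : 1 ≤ p)
    {h : EuclideanSpace ℝ (Fin N) → ℝ} (hh : Continuous h) (hh' : HasCompactSupport h)
    {f : ℕ → EuclideanSpace ℝ (Fin N) → ℝ} {g : EuclideanSpace ℝ (Fin N) → ℝ}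
    (hf : ∀ n, MemLp (f n) p volume) (hg : MemLp g p volume)
    (hfg : Tendsto (fun n => eLpNorm (fun x => f n x - g x) p volume) atTop (𝓝 0)) :
    Tendsto (fun n => ∫ x, h x * f n x) atTop (𝓝 (∫ x, h x * g x)) := by
  have : ENNReal.HolderConjugate p.conjExponent p :=
    (ENNReal.HolderConjugate.conjExponent hp).symm
  have hhq : MemLp h p.conjExponent volume := hh.memLp_of_hasCompactSupport hh'
  refine tendsto_integral_of_L1' _ (hhq.integrable_mul hg).1
    (.of_forall fun n => hhq.integrable_mul (hf n)) ?_
  have hb : ∀ n, eLpNorm ((fun x => h x * f n x) - fun x => h x * g x) 1 volume ≤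
      eLpNorm h p.conjExponent volume * eLpNorm (fun x => f n x - g x) p volume := by
    intro n
    have := eLpNorm_smul_le_mul_eLpNorm (p := p.conjExponent) (q := p) (r := 1) ((hf n).1.sub hg.1) hhq.1
    refine le_trans (le_of_eq ?_) this
    congr 1
    ext x
    simp [mul_sub]
  refine tendsto_of_tendsto_of_tendsto_of_le_of_le tendsto_const_nhds ?_ (fun n => zero_le) hb
  simpa using ENNReal.Tendsto.const_mul hfg (Or.inr hhq.eLpNorm_ne_top)

/-- Integrating `ψ n` by parts against a test function and passing to the limit makes `G` the weak
gradient of `u`. A Lipschitz `u` obeys the same formula with its line derivatives, so these agree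
with `inner ℝ v (G x)` almost everywhere. The basis directions and Rademacher's theorem then give
the full gradient. -/
theorem HasGradD12.gradient_ae_eq (hN : 3 ≤ N) {u : EuclideanSpace ℝ (Fin N) → ℝ}
    {G : EuclideanSpace ℝ (Fin N) → EuclideanSpace ℝ (Fin N)} {C : NNReal}
    (hu : HasGradD12 u G) (hL : LipschitzWith C u) : gradient u =ᵐ[volume] G := by
  obtain ⟨hu, hG, ψ, hψ, h1, h2⟩ := hu
  have hψL : ∀ n, ∃ K, LipschitzWith K (ψ n) := fun n =>
    (hψ n).1.lipschitzWith_of_hasCompactSupport (hψ n).2 (by simp)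
  have hψgrad : ∀ n v x, lineDeriv ℝ (ψ n) x v = inner ℝ v (gradient (ψ n) x) := by
    intro n v x
    rw [((hψ n).1.differentiable (by simp) x).lineDeriv_eq_fderiv, ← toDual_gradient,
      InnerProductSpace.toDual_apply_apply, real_inner_comm]
  have hline : ∀ v : EuclideanSpace ℝ (Fin N),
      ∀ᵐ x ∂volume, lineDeriv ℝ u x v = inner ℝ v (G x) := by
    intro v
    refine ae_eq_of_integral_contDiff_smul_eq (hL.locallyIntegrable_lineDeriv v)
      ((hG.const_inner v).locallyIntegrable one_le_two) fun η hη hη' => ?_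
    obtain ⟨D, hD⟩ := hη.lipschitzWith_of_hasCompactSupport hη' (by simp)
    have hηd : (fun x => lineDeriv ℝ η x (-v)) = fun x => fderiv ℝ η x (-v) := by
      ext x
      exact (hη.differentiable (by simp) x).lineDeriv_eq_fderiv
    have hA : Tendsto (fun n => ∫ x, lineDeriv ℝ η x (-v) * ψ n x) atTop
        (𝓝 (∫ x, lineDeriv ℝ η x (-v) * u x)) := by
      refine tendsto_integral_mul_of_tendsto_eLpNorm (one_le_critExponent hN) ?_ ?_
        (fun n => (hψ n).1.continuous.memLp_of_hasCompactSupport (hψ n).2) hu h1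
      · rw [hηd]
        exact (hη.continuous_fderiv (by simp)).clm_apply continuous_const
      · rw [hηd]
        exact hη'.fderiv_apply ℝ (-v)
    have hB : Tendsto (fun n => ∫ x, η x * inner ℝ v (gradient (ψ n) x)) atTop
        (𝓝 (∫ x, η x * inner ℝ v (G x))) := by
      have hcs : ∀ n, HasCompactSupport (gradient (ψ n)) := fun n =>
        ((hψ n).2.fderiv (𝕜 := ℝ)).comp_left (map_zero _)
      refine tendsto_integral_mul_of_tendsto_eLpNorm one_le_two hη.continuous hη'
        (fun n => ((continuous_gradient (hψ n).1).memLp_of_hasCompactSupport (hcs n)).const_inner v)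
        (hG.const_inner v) ?_
      have hlim := ENNReal.Tendsto.const_mul (a := ENNReal.ofReal ‖v‖) h2
        (Or.inr ENNReal.ofReal_ne_top)
      rw [mul_zero] at hlim
      refine tendsto_of_tendsto_of_tendsto_of_le_of_le tendsto_const_nhds hlim
        (fun n => zero_le) (fun n => ?_)
      refine eLpNorm_le_mul_eLpNorm_of_ae_le_mul (.of_forall fun x => ?_) 2
      rw [← inner_sub_right]
      exact norm_inner_le_norm _ _
    have hC : ∀ n, ∫ x, lineDeriv ℝ η x (-v) * ψ n x =
        ∫ x, η x * inner ℝ v (gradient (ψ n) x) := by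
      intro n
      obtain ⟨K, hK⟩ := hψL n
      rw [← hK.integral_lineDeriv_mul_eq hD hη' v]
      simp_rw [hψgrad, mul_comm]
    simp_rw [hC] at hA
    simp_rw [smul_eq_mul]
    rw [← tendsto_nhds_unique hA hB, ← hL.integral_lineDeriv_mul_eq hD hη' v]
    simp_rw [mul_comm]
  have hall : ∀ᵐ x ∂volume, ∀ i : Fin N,
      lineDeriv ℝ u x (EuclideanSpace.single i 1) = inner ℝ (EuclideanSpace.single i 1) (G x) :=
    ae_all_iff.2 fun i => hline _
  filter_upwards [hall, hL.ae_differentiableAt] with x hx hd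
  ext i
  have := hx i
  rw [hd.lineDeriv_eq_fderiv, ← toDual_gradient, InnerProductSpace.toDual_apply_apply,
    real_inner_comm, EuclideanSpace.inner_single_left, EuclideanSpace.inner_single_left] at this
  simpa only [map_one, one_mul] using this

theorem hasGradD12_gradient (hN : 3 ≤ N) {φ : EuclideanSpace ℝ (Fin N) → ℝ}
    (hφ : φ ∈ admissible N) : HasGradD12 φ (gradient φ) := by
  obtain ⟨h, hL⟩ := hφ
  obtain ⟨G, hG⟩ := memD12_iff.1 h
  have he := hG.gradient_ae_eq hN hL
  obtain ⟨hu, hG, ψ, hψ, h1, h2⟩ := hG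
  refine ⟨hu, hG.ae_eq he.symm, ψ, hψ, h1, h2.congr fun n => ?_⟩
  refine eLpNorm_congr_ae ?_
  filter_upwards [he] with x hx
  rw [hx]

/-! ### Bounds and uniform convexity of the Lagrangian density. -/

/-- The Born-Infeld Lagrangian density `p ↦ 1 - √(1 - |p|²)`. -/
def density {F : Type*} [NormedAddCommGroup F] (p : F) : ℝ := 1 - Real.sqrt (1 - ‖p‖ ^ 2)

section density

variable {F : Type*} [NormedAddCommGroup F] {p q : F}

theorem continuous_density : Continuous (density (F := F)) := by
  unfold density
  fun_prop

theorem density_nonneg (p : F) : 0 ≤ density p := by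
  have : Real.sqrt (1 - ‖p‖ ^ 2) ≤ 1 :=
    Real.sqrt_le_one.2 (by nlinarith [sq_nonneg ‖p‖])
  unfold density
  linarith

theorem density_le_norm_sq (hp : ‖p‖ ≤ 1) : density p ≤ ‖p‖ ^ 2 := by
  have h0 : 0 ≤ 1 - ‖p‖ ^ 2 := by nlinarith [norm_nonneg p]
  have : 1 - ‖p‖ ^ 2 ≤ Real.sqrt (1 - ‖p‖ ^ 2) := by
    apply Real.le_sqrt_of_sq_le
    nlinarith [sq_nonneg ‖p‖]
  unfold density
  linarith

theorem half_norm_sq_le_density (hp : ‖p‖ ≤ 1) : ‖p‖ ^ 2 / 2 ≤ density p := by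
  have h0 : 0 ≤ 1 - ‖p‖ ^ 2 := by nlinarith [norm_nonneg p]
  have : Real.sqrt (1 - ‖p‖ ^ 2) ≤ 1 - ‖p‖ ^ 2 / 2 := by
    rw [Real.sqrt_le_left (by nlinarith [sq_nonneg ‖p‖])]
    nlinarith [sq_nonneg (‖p‖ ^ 2)]
  unfold density
  linarith

theorem density_midpoint_add_le [InnerProductSpace ℝ F] (hp : ‖p‖ ≤ 1) (hq : ‖q‖ ≤ 1) :
    density ((1 / 2 : ℝ) • p + (1 / 2 : ℝ) • q) + ‖(1 / 2 : ℝ) • p + (-1 / 2 : ℝ) • q‖ ^ 2 / 2 ≤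
      (density p + density q) / 2 := by
  have hpar := parallelogram_law_with_norm ℝ ((1 / 2 : ℝ) • p) ((1 / 2 : ℝ) • q)
  have e : (1 / 2 : ℝ) • p + (-1 / 2 : ℝ) • q = (1 / 2 : ℝ) • p - (1 / 2 : ℝ) • q := by
    rw [neg_div, neg_smul, sub_eq_add_neg]
  rw [e]
  simp only [norm_smul, Real.norm_eq_abs, abs_of_pos (one_half_pos (α := ℝ))] at hpar
  set s := ‖(1 / 2 : ℝ) • p + (1 / 2 : ℝ) • q‖
  set d := ‖(1 / 2 : ℝ) • p - (1 / 2 : ℝ) • q‖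
  have hp0 : 0 ≤ 1 - ‖p‖ ^ 2 := by nlinarith [norm_nonneg p]
  have hq0 : 0 ≤ 1 - ‖q‖ ^ 2 := by nlinarith [norm_nonneg q]
  unfold density
  have ha := Real.sq_sqrt hp0
  have hb := Real.sq_sqrt hq0
  have ha0 := Real.sqrt_nonneg (1 - ‖p‖ ^ 2)
  have hb0 := Real.sqrt_nonneg (1 - ‖q‖ ^ 2)
  have ha1 : Real.sqrt (1 - ‖p‖ ^ 2) ≤ 1 := Real.sqrt_le_one.2 (by nlinarith [sq_nonneg ‖p‖])
  have hb1 : Real.sqrt (1 - ‖q‖ ^ 2) ≤ 1 := Real.sqrt_le_one.2 (by nlinarith [sq_nonneg ‖q‖])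
  set a := Real.sqrt (1 - ‖p‖ ^ 2)
  set b := Real.sqrt (1 - ‖q‖ ^ 2)
  -- The parallelogram law reads `1 - s² = (a² + b²) / 2 + d²`. After squaring, `hkey` becomes `(a -
  -- b)² / 4 + d² (1 - (a + b) / 2 - d² / 4) ≥ 0`. By `hd`, twice the last bracket is at least `((1
  -- - a)(3 - a) + (1 - b)(3 - b)) / 4`, which is nonnegative.
  have hd : d ^ 2 ≤ 1 - (a ^ 2 + b ^ 2) / 2 := by nlinarith [sq_nonneg s]
  have hkey : (a + b) / 2 + d ^ 2 / 2 ≤ Real.sqrt (1 - s ^ 2) := by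
    apply Real.le_sqrt_of_sq_le
    have h1 : 0 ≤ d ^ 2 * (2 - (a + b) - (1 - (a ^ 2 + b ^ 2) / 2) / 2) :=
      mul_nonneg (sq_nonneg d) (by nlinarith)
    have h2 : d ^ 2 * d ^ 2 ≤ d ^ 2 * (1 - (a ^ 2 + b ^ 2) / 2) :=
      mul_le_mul_of_nonneg_left hd (sq_nonneg d)
    nlinarith [sq_nonneg (a - b)]
  linarith

end density

/-! ### The admissible set and its Dirichlet norm. -/

theorem zero_mem_admissible : (fun _ => (0 : ℝ)) ∈ admissible N :=
  ⟨memD12_iff.2 ⟨_, HasGradD12.zero⟩, LipschitzWith.const' 0⟩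

/-- The condition on `a`, `b` covers midpoints, contractions `t φ` and half differences. A full
difference may only be `2`-Lipschitz, hence the halves used throughout. -/
theorem linear_comb_mem_admissible (hN : 3 ≤ N) {φ ψ : EuclideanSpace ℝ (Fin N) → ℝ}
    (hφ : φ ∈ admissible N) (hψ : ψ ∈ admissible N) {a b : ℝ} (hab : |a| + |b| ≤ 1) :
    (fun x => a * φ x + b * ψ x) ∈ admissible N := by
  refine ⟨memD12_iff.2 ⟨_, (hasGradD12_gradient hN hφ).linear_comb hN
    (hasGradD12_gradient hN hψ) a b⟩, LipschitzWith.of_dist_le_mul fun x y => ?_⟩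
  have h1 := hφ.2.dist_le_mul x y
  have h2 := hψ.2.dist_le_mul x y
  simp only [NNReal.coe_one, one_mul, Real.dist_eq] at h1 h2 ⊢
  calc |a * φ x + b * ψ x - (a * φ y + b * ψ y)|
      = |a * (φ x - φ y) + b * (ψ x - ψ y)| := by ring_nf
    _ ≤ |a| * |φ x - φ y| + |b| * |ψ x - ψ y| := by
        rw [← abs_mul, ← abs_mul]; exact abs_add_le _ _
    _ ≤ |a| * dist x y + |b| * dist x y := by gcongr
    _ = (|a| + |b|) * dist x y := by ring
    _ ≤ dist x y := mul_le_of_le_one_left dist_nonneg hab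

theorem gradient_linear_comb_ae {φ ψ : EuclideanSpace ℝ (Fin N) → ℝ}
    (hφ : φ ∈ admissible N) (hψ : ψ ∈ admissible N) (a b : ℝ) :
    gradient (fun x => a * φ x + b * ψ x) =ᵐ[volume] fun x => a • gradient φ x + b • gradient ψ x := by
  filter_upwards [hφ.2.ae_differentiableAt, hψ.2.ae_differentiableAt] with x h1 h2
  exact gradient_linear_comb h1 h2 a b

/-- The Dirichlet norm `‖∇φ‖_{L²}`. -/
def gradNorm (φ : EuclideanSpace ℝ (Fin N) → ℝ) : ℝ := (eLpNorm (gradient φ) 2 volume).toReal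

theorem gradNorm_nonneg (φ : EuclideanSpace ℝ (Fin N) → ℝ) : 0 ≤ gradNorm φ := ENNReal.toReal_nonneg

theorem memLp_gradient (hN : 3 ≤ N) {φ : EuclideanSpace ℝ (Fin N) → ℝ} (hφ : φ ∈ admissible N) :
    MemLp (gradient φ) 2 volume := (hasGradD12_gradient hN hφ).2.1

theorem eLpNorm_gradient (hN : 3 ≤ N) {φ : EuclideanSpace ℝ (Fin N) → ℝ}
    (hφ : φ ∈ admissible N) : eLpNorm (gradient φ) 2 volume = ENNReal.ofReal (gradNorm φ) :=
  (ENNReal.ofReal_toReal (memLp_gradient hN hφ).eLpNorm_ne_top).symm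

theorem integral_norm_gradient_sq (hN : 3 ≤ N) {φ : EuclideanSpace ℝ (Fin N) → ℝ}
    (hφ : φ ∈ admissible N) : ∫ x, ‖gradient φ x‖ ^ 2 = gradNorm φ ^ 2 := by
  have h0 : 0 ≤ ∫ x, ‖gradient φ x‖ ^ 2 := integral_nonneg fun x => sq_nonneg _
  rw [gradNorm, (memLp_gradient hN hφ).eLpNorm_eq_integral_rpow_norm two_ne_zero ENNReal.ofNat_ne_top]
  simp only [ENNReal.toReal_ofNat, Real.rpow_ofNat]
  rw [ENNReal.toReal_ofReal (Real.rpow_nonneg h0 _), ← Real.rpow_natCast, ← Real.rpow_mul h0]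
  norm_num

theorem integrable_norm_gradient_sq (hN : 3 ≤ N) {φ : EuclideanSpace ℝ (Fin N) → ℝ}
    (hφ : φ ∈ admissible N) : Integrable (fun x => ‖gradient φ x‖ ^ 2) volume :=
  (memLp_gradient hN hφ).integrable_norm_pow two_ne_zero

theorem integrable_density (hN : 3 ≤ N) {φ : EuclideanSpace ℝ (Fin N) → ℝ}
    (hφ : φ ∈ admissible N) : Integrable (fun x => density (gradient φ x)) volume := by
  refine (integrable_norm_gradient_sq hN hφ).mono'
    (continuous_density.comp_aestronglyMeasurable (memLp_gradient hN hφ).1) (.of_forall fun x => ?_)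
  rw [Real.norm_eq_abs, abs_of_nonneg (density_nonneg _)]
  exact density_le_norm_sq (norm_gradient_le hφ.2 x)

/-! ### Uniform bounds by the Dirichlet norm, and boundedness below of the action. -/

/-- A `1`-Lipschitz function with small Dirichlet norm is uniformly small. -/
theorem exists_gradNorm_le_imp_abs_le (hN : 3 ≤ N) {ε : ℝ} (hε : 0 < ε) :
    ∃ δ > 0, ∀ φ ∈ admissible N, gradNorm φ ≤ δ → ∀ x, |φ x| ≤ ε := by
  obtain ⟨C, hC⟩ := exists_sobolev_const hN
  have hp0 : critExponent N ≠ 0 := (zero_lt_one.trans_le (one_le_critExponent hN)).ne'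
  have hpt : critExponent N ≠ ⊤ := critExponent_ne_top
  -- If `|φ x| > ε`, then `|φ| ≥ ε / 2` on the ball of radius `ε / 2` about `x`. By Chebyshev, `c`
  -- then bounds the critical power integral from below, while Sobolev makes that integral less than
  -- `c` for small Dirichlet norm.
  set c : ℝ≥0∞ := ENNReal.ofReal (ε / 2) ^ (critExponent N).toReal *
    volume (Metric.ball (0 : EuclideanSpace ℝ (Fin N)) (ε / 2)) with hc
  have hcpos : 0 < c := by
    refine ENNReal.mul_pos (ENNReal.rpow_pos ?_ ENNReal.ofReal_ne_top).ne' ?_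
    · simpa using half_pos hε
    · exact (Metric.measure_ball_pos volume _ (half_pos hε)).ne'
  have hlim : Tendsto (fun t : ℝ => (C * ENNReal.ofReal t) ^ (critExponent N).toReal) (𝓝 0)
      (𝓝 0) := by
    have h1 : Tendsto (fun t : ℝ => (C : ℝ≥0∞) * ENNReal.ofReal t) (𝓝 0) (𝓝 0) := by
      have := ENNReal.Tendsto.const_mul (a := (C : ℝ≥0∞))
        (ENNReal.tendsto_ofReal (tendsto_id (x := 𝓝 (0 : ℝ)))) (Or.inr ENNReal.coe_ne_top)
      simpa using this
    have h2 := h1.ennrpow_const (critExponent N).toReal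
    rwa [ENNReal.zero_rpow_of_pos (ENNReal.toReal_pos hp0 hpt)] at h2
  obtain ⟨δ, hδ, hball⟩ := Metric.eventually_nhds_iff.1 (hlim.eventually_lt_const hcpos)
  refine ⟨δ / 2, half_pos hδ, fun φ hφ hg x => ?_⟩
  by_contra! hx
  have hg' : (C * ENNReal.ofReal (gradNorm φ)) ^ (critExponent N).toReal < c := by
    refine hball ?_
    rw [Real.dist_eq, sub_zero, abs_of_nonneg (gradNorm_nonneg φ)]
    linarith
  have hsub : Metric.ball x (ε / 2) ⊆ {y | ENNReal.ofReal (ε / 2) ≤ ‖φ y‖ₑ} := by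
    intro y hy
    have h1 := hφ.2.dist_le_mul x y
    rw [Metric.mem_ball'] at hy
    simp only [NNReal.coe_one, one_mul, Real.dist_eq] at h1
    have h2 := abs_sub_abs_le_abs_sub (φ x) (φ y)
    rw [Set.mem_ofPred_eq, ← ofReal_norm, Real.norm_eq_abs]
    exact ENNReal.ofReal_le_ofReal (by linarith)
  have hM := mul_meas_ge_le_pow_eLpNorm' volume hp0 hpt (hasGradD12_gradient hN hφ).1.1
    (ENNReal.ofReal (ε / 2))
  have hS := hC φ _ (hasGradD12_gradient hN hφ)
  rw [eLpNorm_gradient hN hφ] at hS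
  refine lt_irrefl c (lt_of_le_of_lt ?_ hg')
  calc c = ENNReal.ofReal (ε / 2) ^ (critExponent N).toReal * volume (Metric.ball x (ε / 2)) := by
        rw [hc, Measure.addHaar_ball_center volume x]
    _ ≤ _ := by gcongr
    _ ≤ _ := hM
    _ ≤ _ := by gcongr

theorem gradNorm_const_mul {φ : EuclideanSpace ℝ (Fin N) → ℝ} (hφ : φ ∈ admissible N)
    {t : ℝ} (ht : 0 ≤ t) : gradNorm (fun x => t * φ x + 0 * φ x) = t * gradNorm φ := by
  rw [gradNorm, eLpNorm_congr_ae (gradient_linear_comb_ae hφ hφ t 0)]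
  have : (fun x => t • gradient φ x + (0 : ℝ) • gradient φ x) = t • gradient φ := by
    ext1 x; simp
  rw [this, eLpNorm_const_smul, ENNReal.toReal_mul, gradNorm, toReal_enorm, Real.norm_eq_abs,
    abs_of_nonneg ht]

/-- Scale `φ` down by `t = δ / (δ + gradNorm φ) ≤ 1`: it stays in `X` and has Dirichlet norm at most
`δ`, so `|t φ| ≤ 1`. -/
theorem exists_abs_le_mul_one_add_gradNorm (hN : 3 ≤ N) :
    ∃ M, 0 ≤ M ∧ ∀ φ ∈ admissible N, ∀ x, |φ x| ≤ M * (1 + gradNorm φ) := by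
  obtain ⟨δ, hδ, h⟩ := exists_gradNorm_le_imp_abs_le hN one_pos
  refine ⟨1 + 1 / δ, by positivity, fun φ hφ x => ?_⟩
  have hg := gradNorm_nonneg φ
  have hpos : 0 < δ + gradNorm φ := by linarith
  set t := δ / (δ + gradNorm φ) with ht
  have ht0 : 0 < t := by positivity
  have ht1 : t ≤ 1 := (div_le_one hpos).2 (by linarith)
  have hadm := linear_comb_mem_admissible hN hφ hφ (a := t) (b := 0)
    (by rw [abs_zero, add_zero, abs_of_pos ht0]; exact ht1)
  have h1 := h _ hadm (by
    rw [gradNorm_const_mul hφ ht0.le, ht, div_mul_eq_mul_div, div_le_iff₀ hpos]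
    nlinarith) x
  rw [zero_mul, add_zero, abs_mul, abs_of_pos ht0, ht, div_mul_eq_mul_div, div_le_iff₀ hpos] at h1
  have h2 : |φ x| ≤ (δ + gradNorm φ) / δ := by
    rw [le_div_iff₀ hδ]; linarith
  refine h2.trans ?_
  rw [div_le_iff₀ hδ]
  have : (1 + 1 / δ) * (1 + gradNorm φ) * δ = (δ + 1) * (1 + gradNorm φ) := by
    field_simp
  rw [this]
  nlinarith

theorem exists_abs_le (hN : 3 ≤ N) {φ : EuclideanSpace ℝ (Fin N) → ℝ} (hφ : φ ∈ admissible N) :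
    ∃ K, ∀ x, |φ x| ≤ K := by
  obtain ⟨M, -, h⟩ := exists_abs_le_mul_one_add_gradNorm hN
  exact ⟨_, h φ hφ⟩

theorem integrable_of_mem_admissible (hN : 3 ≤ N) {φ : EuclideanSpace ℝ (Fin N) → ℝ}
    (hφ : φ ∈ admissible N) (ρ : ProbabilityMeasure (EuclideanSpace ℝ (Fin N))) :
    Integrable φ (ρ : Measure (EuclideanSpace ℝ (Fin N))) := by
  obtain ⟨K, hK⟩ := exists_abs_le hN hφ
  exact Integrable.of_bound hφ.2.continuous.aestronglyMeasurable K (.of_forall hK)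

theorem bddBelow_action (hN : 3 ≤ N) (ρ : ProbabilityMeasure (EuclideanSpace ℝ (Fin N))) :
    BddBelow (action ρ '' admissible N) := by
  obtain ⟨M, hM0, hM⟩ := exists_abs_le_mul_one_add_gradNorm hN
  -- This is the minimum over `g` of `g² / 2 - M (1 + g)`, attained at `g = M`.
  refine ⟨-(M ^ 2 / 2 + M), ?_⟩
  rintro _ ⟨φ, hφ, rfl⟩
  have h1 : gradNorm φ ^ 2 / 2 ≤ ∫ x, density (gradient φ x) := by
    rw [← integral_norm_gradient_sq hN hφ, ← integral_div]
    exact integral_mono ((integrable_norm_gradient_sq hN hφ).div_const 2)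
      (integrable_density hN hφ) fun x => half_norm_sq_le_density (norm_gradient_le hφ.2 x)
  have h2 : ∫ x, φ x ∂(ρ : Measure (EuclideanSpace ℝ (Fin N))) ≤ M * (1 + gradNorm φ) := by
    have := norm_integral_le_of_norm_le_const (f := φ)
      (μ := (ρ : Measure (EuclideanSpace ℝ (Fin N)))) (.of_forall (hM φ hφ))
    rw [probReal_univ, mul_one] at this
    exact (le_abs_self _).trans this
  change _ ≤ (∫ x, density (gradient φ x)) - _
  nlinarith [sq_nonneg (gradNorm φ - M)]

/-! ### Uniform convexity of the action and uniqueness of the potential. -/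

theorem action_midpoint_add_le (hN : 3 ≤ N)
    (ρ : ProbabilityMeasure (EuclideanSpace ℝ (Fin N))) {φ ψ : EuclideanSpace ℝ (Fin N) → ℝ}
    (hφ : φ ∈ admissible N) (hψ : ψ ∈ admissible N) :
    action ρ (fun x => 1 / 2 * φ x + 1 / 2 * ψ x) +
      gradNorm (fun x => 1 / 2 * φ x + -1 / 2 * ψ x) ^ 2 / 2 ≤ (action ρ φ + action ρ ψ) / 2 := by
  have hs := linear_comb_mem_admissible hN hφ hψ (a := 1 / 2) (b := 1 / 2) (by norm_num [abs_of_pos])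
  have hd := linear_comb_mem_admissible hN hφ hψ (a := 1 / 2) (b := -1 / 2)
    (by norm_num [abs_of_pos, abs_div])
  have hlin : ∫ x, (1 / 2 * φ x + 1 / 2 * ψ x) ∂(ρ : Measure (EuclideanSpace ℝ (Fin N))) =
      1 / 2 * ∫ x, φ x ∂(ρ : Measure (EuclideanSpace ℝ (Fin N))) +
        1 / 2 * ∫ x, ψ x ∂(ρ : Measure (EuclideanSpace ℝ (Fin N))) := by
    rw [integral_add ((integrable_of_mem_admissible hN hφ ρ).const_mul _)
      ((integrable_of_mem_admissible hN hψ ρ).const_mul _), integral_const_mul, integral_const_mul]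
  have hJ : (∫ x, density (gradient (fun x => 1 / 2 * φ x + 1 / 2 * ψ x) x)) +
      gradNorm (fun x => 1 / 2 * φ x + -1 / 2 * ψ x) ^ 2 / 2 ≤
      ((∫ x, density (gradient φ x)) + ∫ x, density (gradient ψ x)) / 2 := by
    rw [← integral_norm_gradient_sq hN hd, ← integral_div,
      ← integral_add (integrable_density hN hs) ((integrable_norm_gradient_sq hN hd).div_const 2),
      ← integral_add (integrable_density hN hφ) (integrable_density hN hψ), ← integral_div]
    refine integral_mono_ae
      ((integrable_density hN hs).add ((integrable_norm_gradient_sq hN hd).div_const 2))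
      (((integrable_density hN hφ).add (integrable_density hN hψ)).div_const 2) ?_
    filter_upwards [gradient_linear_comb_ae hφ hψ (1 / 2) (1 / 2),
      gradient_linear_comb_ae hφ hψ (1 / 2) (-1 / 2)] with x h1 h2
    simp only [h1, h2]
    exact density_midpoint_add_le (norm_gradient_le hφ.2 x) (norm_gradient_le hψ.2 x)
  change (∫ x, density (gradient (fun x => 1 / 2 * φ x + 1 / 2 * ψ x) x)) - _ + _ ≤
    ((∫ x, density (gradient φ x)) - _ + ((∫ x, density (gradient ψ x)) - _)) / 2
  rw [hlin]
  linarith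

theorem IsPotential.eq (hN : 3 ≤ N) {ρ : ProbabilityMeasure (EuclideanSpace ℝ (Fin N))}
    {φ ψ : EuclideanSpace ℝ (Fin N) → ℝ} (hφ : IsPotential ρ φ) (hψ : IsPotential ρ ψ) :
    φ = ψ := by
  have h := action_midpoint_add_le hN ρ hφ.1 hψ.1
  have hs := linear_comb_mem_admissible hN hφ.1 hψ.1 (a := 1 / 2) (b := 1 / 2)
    (by norm_num [abs_of_pos])
  have hd := linear_comb_mem_admissible hN hφ.1 hψ.1 (a := 1 / 2) (b := -1 / 2)
    (by norm_num [abs_of_pos, abs_div])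
  have h1 := hφ.2 _ hs
  have h2 := hψ.2 _ hs
  have hg : gradNorm (fun x => 1 / 2 * φ x + -1 / 2 * ψ x) = 0 := by
    refine pow_eq_zero_iff two_ne_zero |>.1 (le_antisymm (by linarith) (sq_nonneg _))
  ext x
  have h0 : |1 / 2 * φ x + -1 / 2 * ψ x| ≤ 0 := by
    refine le_of_forall_pos_le_add fun ε hε => ?_
    obtain ⟨δ, hδ, H⟩ := exists_gradNorm_le_imp_abs_le hN hε
    rw [zero_add]
    exact H _ hd (hg.trans_le hδ.le) x
  have := abs_nonpos_iff.1 h0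
  linarith

theorem eLpNorm_gradient_sub (hN : 3 ≤ N) {φ ψ : EuclideanSpace ℝ (Fin N) → ℝ}
    (hφ : φ ∈ admissible N) (hψ : ψ ∈ admissible N) :
    eLpNorm (fun x => gradient φ x - gradient ψ x) 2 volume =
      ENNReal.ofReal (2 * gradNorm (fun x => 1 / 2 * φ x + -1 / 2 * ψ x)) := by
  have hd := linear_comb_mem_admissible hN hφ hψ (a := 1 / 2) (b := -1 / 2)
    (by norm_num [abs_of_pos, abs_div])
  have e : (fun x => gradient φ x - gradient ψ x) =ᵐ[volume]
      (2 : ℝ) • gradient (fun x => 1 / 2 * φ x + -1 / 2 * ψ x) := by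
    filter_upwards [gradient_linear_comb_ae hφ hψ (1 / 2) (-1 / 2)] with x hx
    rw [Pi.smul_apply, hx]
    module
  rw [eLpNorm_congr_ae e, eLpNorm_const_smul, eLpNorm_gradient hN hd,
    ENNReal.ofReal_mul zero_le_two, ← ofReal_norm]
  norm_num

/-! ### Completeness and existence of the potential. -/

/-- The set `X` is complete for the Dirichlet norm. -/
theorem exists_admissible_limit (hN : 3 ≤ N) {φ : ℕ → EuclideanSpace ℝ (Fin N) → ℝ}
    (hφ : ∀ n, φ n ∈ admissible N)
    (hc : ∀ ε > 0, ∃ n₀, ∀ n ≥ n₀, ∀ k ≥ n₀,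
      gradNorm (fun x => 1 / 2 * φ n x + -1 / 2 * φ k x) ≤ ε) :
    ∃ u ∈ admissible N,
      Tendsto (fun n => gradNorm (fun x => 1 / 2 * φ n x + -1 / 2 * u x)) atTop (𝓝 0) := by
  have hd : ∀ n k, (fun x => 1 / 2 * φ n x + -1 / 2 * φ k x) ∈ admissible N := fun n k =>
    linear_comb_mem_admissible hN (hφ n) (hφ k) (by norm_num [abs_of_pos, abs_div])
  have hpt : ∀ x, ∃ y, Tendsto (fun n => φ n x) atTop (𝓝 y) := by
    intro x
    apply cauchySeq_tendsto_of_complete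
    rw [Metric.cauchySeq_iff]
    intro ε hε
    obtain ⟨δ, hδ, H⟩ := exists_gradNorm_le_imp_abs_le hN (ε := ε / 4) (by linarith)
    obtain ⟨n₀, hn₀⟩ := hc δ hδ
    refine ⟨n₀, fun n hn k hk => ?_⟩
    have h := H _ (hd n k) (hn₀ n hn k hk) x
    rw [Real.dist_eq]
    have e : φ n x - φ k x = 2 * (1 / 2 * φ n x + -1 / 2 * φ k x) := by ring
    rw [e, abs_mul, abs_two]
    linarith
  choose u hu using hpt
  have hLip : LipschitzWith 1 u := LipschitzWith.of_dist_le_mul fun x y =>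
    le_of_tendsto' ((hu x).dist (hu y)) fun n => (hφ n).2.dist_le_mul x y
  have hCau : ∀ ε : ℝ≥0∞, 0 < ε → ∃ n₀, ∀ n ≥ n₀, ∀ k ≥ n₀,
      eLpNorm (fun x => gradient (φ n) x - gradient (φ k) x) 2 volume < ε := by
    intro ε hε
    obtain ⟨r, hr0, hr⟩ := ENNReal.lt_iff_exists_nnreal_btwn.1 hε
    have hr0' : (0 : ℝ) < r := by exact_mod_cast hr0
    obtain ⟨n₀, hn₀⟩ := hc (r / 2) (half_pos hr0')
    refine ⟨n₀, fun n hn k hk => lt_of_le_of_lt ?_ hr⟩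
    rw [eLpNorm_gradient_sub hN (hφ n) (hφ k), ← ENNReal.ofReal_coe_nnreal]
    exact ENNReal.ofReal_le_ofReal (by linarith [hn₀ n hn k hk])
  obtain ⟨G, hG, hGlim⟩ : ∃ G, MemLp G 2 volume ∧
      Tendsto (fun n => eLpNorm (fun x => gradient (φ n) x - G x) 2 volume) atTop (𝓝 0) := by
    have hcs : CauchySeq fun n => (memLp_gradient hN (hφ n)).toLp (gradient (φ n)) := by
      rw [EMetric.cauchySeq_iff]
      intro ε hε
      obtain ⟨n₀, hn₀⟩ := hCau ε hε
      refine ⟨n₀, fun n hn k hk => ?_⟩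
      rw [Lp.edist_toLp_toLp]
      exact hn₀ n hn k hk
    obtain ⟨G, hG⟩ := cauchySeq_tendsto_of_complete hcs
    refine ⟨G, Lp.memLp G, ?_⟩
    rw [← Lp.toLp_coeFn G (Lp.memLp G)] at hG
    exact (Lp.tendsto_Lp_iff_tendsto_eLpNorm'' _ (fun n => memLp_gradient hN (hφ n)) _ _).1 hG
  obtain ⟨C, hC⟩ := exists_sobolev_const hN
  have hulim : Tendsto (fun n => eLpNorm (fun x => φ n x - u x) (critExponent N) volume)
      atTop (𝓝 0) := by
    rw [ENNReal.tendsto_atTop_zero]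
    intro ε hε
    -- `C + 1` instead of `C`, since `C` could be zero.
    have hpos : 0 < ε / (C + 1) :=
      ENNReal.div_pos hε.ne' (ENNReal.add_ne_top.2 ⟨ENNReal.coe_ne_top, ENNReal.one_ne_top⟩)
    obtain ⟨n₀, hn₀⟩ := hCau _ hpos
    refine ⟨n₀, fun n hn => ?_⟩
    -- Fatou in `k`: the critical norm of `φ n - φ k` is at most `ε` by Sobolev, and `φ k → u`
    -- pointwise.
    refine Lp.eLpNorm_le_of_ae_tendsto (u := atTop) (f := fun k x => φ n x - φ k x) ?_
      (fun k => ((hφ n).2.continuous.sub (hφ k).2.continuous).aestronglyMeasurable)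
      (.of_forall fun x => tendsto_const_nhds.sub (hu x))
    filter_upwards [eventually_ge_atTop n₀] with k hk
    have h1 := hC _ _ ((hasGradD12_gradient hN (hφ n)).linear_comb hN
      (hasGradD12_gradient hN (hφ k)) 1 (-1))
    simp only [one_mul, neg_mul, one_smul, neg_smul, ← sub_eq_add_neg] at h1
    calc _ ≤ _ := h1
      _ ≤ (C + 1) * (ε / (C + 1)) := by
          gcongr
          · exact le_self_add
          · exact (hn₀ n hn k hk).le
      _ ≤ ε := ENNReal.mul_div_le
  have huLp : MemLp u (critExponent N) volume := by
    obtain ⟨n, hn⟩ := (hulim.eventually_lt_const (zero_lt_one)).exists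
    have h1 : MemLp (fun x => φ n x - u x) (critExponent N) volume :=
      ⟨((hφ n).2.continuous.sub hLip.continuous).aestronglyMeasurable, hn.trans ENNReal.one_lt_top⟩
    have h2 := (hasGradD12_gradient hN (hφ n)).1.sub h1
    convert h2 using 1
    ext x
    simp
  have hgrad : HasGradD12 u G :=
    HasGradD12.of_tendsto hN (fun n => hasGradD12_gradient hN (hφ n)) huLp hG hulim hGlim
  have huadm : u ∈ admissible N := ⟨memD12_iff.2 ⟨G, hgrad⟩, hLip⟩
  refine ⟨u, huadm, ?_⟩
  have h3 : ∀ n, eLpNorm (fun x => gradient (φ n) x - G x) 2 volume =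
      ENNReal.ofReal (2 * gradNorm (fun x => 1 / 2 * φ n x + -1 / 2 * u x)) := by
    intro n
    rw [← eLpNorm_gradient_sub hN (hφ n) huadm]
    refine eLpNorm_congr_ae ?_
    filter_upwards [hgrad.gradient_ae_eq hN hLip] with x hx
    rw [hx]
  simp_rw [h3] at hGlim
  have h4 := (ENNReal.tendsto_toReal ENNReal.zero_ne_top).comp hGlim
  have h5 := h4.const_mul (1 / 2)
  refine (h5.congr fun n => ?_).trans (by simp)
  rw [Function.comp_apply, ENNReal.toReal_ofReal (mul_nonneg zero_le_two (gradNorm_nonneg _))]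
  ring

theorem integral_le_of_tendsto_ae {α : Type*} [MeasurableSpace α] {μ : Measure α}
    {f : ℕ → α → ℝ} {g : α → ℝ} {L : ℝ} (hf : ∀ n, Integrable (f n) μ) (hf0 : ∀ n x, 0 ≤ f n x)
    (hg : Integrable g μ) (hg0 : ∀ x, 0 ≤ g x)
    (hfg : ∀ᵐ x ∂μ, Tendsto (fun n => f n x) atTop (𝓝 (g x)))
    (hL : Tendsto (fun n => ∫ x, f n x ∂μ) atTop (𝓝 L)) : ∫ x, g x ∂μ ≤ L := by
  have hL0 : 0 ≤ L := ge_of_tendsto' hL fun n => integral_nonneg (hf0 n)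
  rw [← ENNReal.ofReal_le_ofReal_iff hL0, ofReal_integral_eq_lintegral_ofReal hg (.of_forall hg0)]
  have h1 : Tendsto (fun n => ∫⁻ x, ENNReal.ofReal (f n x) ∂μ) atTop (𝓝 (ENNReal.ofReal L)) := by
    refine (ENNReal.tendsto_ofReal hL).congr fun n => ?_
    exact ofReal_integral_eq_lintegral_ofReal (hf n) (.of_forall (hf0 n))
  rw [← h1.liminf_eq]
  calc ∫⁻ x, ENNReal.ofReal (g x) ∂μ
      = ∫⁻ x, liminf (fun n => ENNReal.ofReal (f n x)) atTop ∂μ := by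
        refine lintegral_congr_ae ?_
        filter_upwards [hfg] with x hx
        exact (ENNReal.tendsto_ofReal hx).liminf_eq.symm
    _ ≤ _ := lintegral_liminf_le' fun n => (hf n).1.aemeasurable.ennreal_ofReal

theorem tendsto_integral_of_tendsto_gradNorm (hN : 3 ≤ N)
    (ρ : ProbabilityMeasure (EuclideanSpace ℝ (Fin N))) {φ : ℕ → EuclideanSpace ℝ (Fin N) → ℝ}
    {u : EuclideanSpace ℝ (Fin N) → ℝ} (hφ : ∀ n, φ n ∈ admissible N) (hu : u ∈ admissible N)
    (h : Tendsto (fun n => gradNorm (fun x => 1 / 2 * φ n x + -1 / 2 * u x)) atTop (𝓝 0)) :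
    Tendsto (fun n => ∫ x, φ n x ∂(ρ : Measure (EuclideanSpace ℝ (Fin N)))) atTop
      (𝓝 (∫ x, u x ∂(ρ : Measure (EuclideanSpace ℝ (Fin N))))) := by
  rw [Metric.tendsto_atTop]
  intro ε hε
  obtain ⟨δ, hδ, H⟩ := exists_gradNorm_le_imp_abs_le hN (ε := ε / 4) (by linarith)
  obtain ⟨n₀, hn₀⟩ := eventually_atTop.1 (h.eventually_lt_const hδ)
  refine ⟨n₀, fun n hn => ?_⟩
  have hpt : ∀ x, ‖φ n x - u x‖ ≤ ε / 2 := by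
    intro x
    have h := H _ (linear_comb_mem_admissible hN (hφ n) hu (by norm_num [abs_of_pos, abs_div]))
      (hn₀ n hn).le x
    have e : φ n x - u x = 2 * (1 / 2 * φ n x + -1 / 2 * u x) := by ring
    rw [Real.norm_eq_abs, e, abs_mul, abs_two]
    linarith
  have := norm_integral_le_of_norm_le_const
    (μ := (ρ : Measure (EuclideanSpace ℝ (Fin N)))) (.of_forall hpt)
  rw [probReal_univ, mul_one, integral_sub (integrable_of_mem_admissible hN (hφ n) ρ)
    (integrable_of_mem_admissible hN hu ρ)] at this
  rw [dist_eq_norm]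
  linarith

theorem exists_isPotential (hN : 3 ≤ N) (ρ : ProbabilityMeasure (EuclideanSpace ℝ (Fin N))) :
    ∃ φ, IsPotential ρ φ := by
  have hbdd := bddBelow_action hN ρ
  have hne : (action ρ '' admissible N).Nonempty := ⟨_, _, zero_mem_admissible, rfl⟩
  set m := sInf (action ρ '' admissible N)
  have hm : ∀ φ ∈ admissible N, m ≤ action ρ φ := fun φ hφ => csInf_le hbdd ⟨φ, hφ, rfl⟩
  have hex : ∀ n : ℕ, ∃ φ ∈ admissible N, action ρ φ < m + 1 / ((n : ℝ) + 1) := by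
    intro n
    obtain ⟨_, ⟨φ, hφ, rfl⟩, h⟩ := exists_lt_of_csInf_lt hne
      (lt_add_of_pos_right m (Nat.one_div_pos_of_nat (n := n) (α := ℝ)))
    exact ⟨φ, hφ, h⟩
  choose φ hφ hφm using hex
  have hlim0 := tendsto_one_div_add_atTop_nhds_zero_nat (𝕜 := ℝ)
  have hact : Tendsto (fun n => action ρ (φ n)) atTop (𝓝 m) := by
    refine tendsto_of_tendsto_of_tendsto_of_le_of_le tendsto_const_nhds
      (by simpa using hlim0.const_add m) (fun n => hm _ (hφ n)) (fun n => (hφm n).le)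
  have hc : ∀ ε > 0, ∃ n₀, ∀ n ≥ n₀, ∀ k ≥ n₀,
      gradNorm (fun x => 1 / 2 * φ n x + -1 / 2 * φ k x) ≤ ε := by
    intro ε hε
    -- The midpoint has action at least `m`, so half the squared Dirichlet norm of the half
    -- difference is at most the mean excess of the two actions over `m`.
    have hlt : m < m + ε ^ 2 / 2 := by nlinarith [sq_pos_of_pos hε]
    obtain ⟨n₀, hn₀⟩ := eventually_atTop.1 (hact.eventually_lt_const hlt)
    refine ⟨n₀, fun n hn k hk => ?_⟩
    have h1 := action_midpoint_add_le hN ρ (hφ n) (hφ k)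
    have h2 := hm _ (linear_comb_mem_admissible hN (hφ n) (hφ k) (a := 1 / 2) (b := 1 / 2)
      (by norm_num [abs_of_pos]))
    exact le_of_sq_le_sq (by linarith [hn₀ n hn, hn₀ k hk]) hε.le
  obtain ⟨u, hu, hulim⟩ := exists_admissible_limit hN hφ hc
  have hint := tendsto_integral_of_tendsto_gradNorm hN ρ hφ hu hulim
  have hJ : Tendsto (fun n => ∫ x, density (gradient (φ n) x)) atTop
      (𝓝 (m + ∫ x, u x ∂(ρ : Measure (EuclideanSpace ℝ (Fin N))))) := by
    refine (hact.add hint).congr fun n => ?_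
    exact sub_add_cancel _ _
  have hL2 : Tendsto (fun n => eLpNorm (gradient (φ n) - gradient u) 2 volume) atTop (𝓝 0) := by
    have h1 : ∀ n, eLpNorm (gradient (φ n) - gradient u) 2 volume =
        ENNReal.ofReal (2 * gradNorm (fun x => 1 / 2 * φ n x + -1 / 2 * u x)) := fun n =>
      eLpNorm_gradient_sub hN (hφ n) hu
    simp_rw [h1]
    simpa using ENNReal.tendsto_ofReal (hulim.const_mul 2)
  -- Fatou needs almost everywhere convergence of the gradients, which `L²` convergence gives along
  -- a subsequence.
  obtain ⟨ns, hns, hae⟩ := (tendstoInMeasure_of_tendsto_eLpNorm two_ne_zero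
    (fun n => (memLp_gradient hN (hφ n)).1) (memLp_gradient hN hu).1 hL2).exists_seq_tendsto_ae
  have hle : ∫ x, density (gradient u x) ≤
      m + ∫ x, u x ∂(ρ : Measure (EuclideanSpace ℝ (Fin N))) := by
    refine integral_le_of_tendsto_ae (f := fun n x => density (gradient (φ (ns n)) x))
      (fun n => integrable_density hN (hφ _)) (fun n x => density_nonneg _)
      (integrable_density hN hu) (fun x => density_nonneg _) ?_ (hJ.comp hns.tendsto_atTop)
    filter_upwards [hae] with x hx
    exact (continuous_density.tendsto _).comp hx
  refine ⟨u, hu, fun ψ hψ => le_trans ?_ (hm ψ hψ)⟩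
  change (∫ x, density (gradient u x)) - _ ≤ m
  linarith

/-! ### Weak compactness and the equilibrium measure. -/

theorem isCompact_boundaryMeasures {Ω : Set (EuclideanSpace ℝ (Fin N))}
    (hΩ : Bornology.IsBounded Ω) : IsCompact (boundaryMeasures Ω) := by
  have hK : IsCompact (frontier Ω) :=
    Metric.isCompact_of_isClosed_isBounded isClosed_frontier
      (hΩ.closure.subset frontier_subset_closure)
  -- Prokhorov's theorem in its simplest case: one compact set `frontier Ω`, with mass tolerance `0`
  -- outside it.
  have h := isCompact_setOfPred_probabilityMeasure_mass_eq_compl_isCompact_le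
    (E := EuclideanSpace ℝ (Fin N)) (u := fun _ => 0) (K := fun _ => frontier Ω)
    tendsto_const_nhds (fun _ => hK) (Or.inl inferInstance)
  convert h using 1
  ext ρ
  simp [boundaryMeasures, ProbabilityMeasure.null_iff_toMeasure_null]

theorem boundaryMeasures_nonempty (hN : 3 ≤ N) {Ω : Set (EuclideanSpace ℝ (Fin N))}
    (hne : Ω.Nonempty) (hΩ : Bornology.IsBounded Ω) : (boundaryMeasures Ω).Nonempty := by
  have : Nonempty (Fin N) := ⟨⟨0, by omega⟩⟩
  obtain ⟨x, hx⟩ : (frontier Ω).Nonempty := by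
    refine nonempty_frontier_iff.2 ⟨hne, ?_⟩
    rintro rfl
    exact NormedSpace.unbounded_univ ℝ _ hΩ
  refine ⟨⟨Measure.dirac x, inferInstance⟩, ?_⟩
  change Measure.dirac x (frontier Ω)ᶜ = 0
  rw [Measure.dirac_apply' _ isClosed_frontier.measurableSet.compl]
  simpa using hx

theorem continuous_energy (hN : 3 ≤ N) {φ : EuclideanSpace ℝ (Fin N) → ℝ}
    (hφ : φ ∈ admissible N) : Continuous fun ρ => energy ρ φ := by
  obtain ⟨K, hK⟩ := exists_abs_le hN hφ
  let f : BoundedContinuousFunction (EuclideanSpace ℝ (Fin N)) ℝ :=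
    BoundedContinuousFunction.ofNormedAddCommGroup φ hφ.2.continuous K hK
  have h : Continuous fun ρ : ProbabilityMeasure (EuclideanSpace ℝ (Fin N)) =>
      ∫ x, φ x ∂(ρ : Measure (EuclideanSpace ℝ (Fin N))) :=
    continuous_iff_continuousAt.2 fun ρ =>
      ProbabilityMeasure.tendsto_iff_forall_integral_tendsto.1 tendsto_id f
  exact (continuous_const.sub h).neg

theorem exists_isEquilibriumMeasure (hN : 3 ≤ N) {Ω : Set (EuclideanSpace ℝ (Fin N))}
    (hne : Ω.Nonempty) (hΩ : Bornology.IsBounded Ω) : ∃ ρ, IsEquilibriumMeasure Ω ρ := by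
  choose φ hφ using exists_isPotential hN
  -- Freeze the potential of `ρ₀`: its energy is continuous in `ρ`, equals the minimal energy at
  -- `ρ₀`, and bounds it from below elsewhere because `φ ρ` minimizes the action.
  have hlsc : LowerSemicontinuous fun ρ => energy ρ (φ ρ) := by
    intro ρ₀ y hy
    filter_upwards [(continuous_energy hN (hφ ρ₀).1).continuousAt.eventually_const_lt hy] with ρ hρ
    exact hρ.trans_le (neg_le_neg ((hφ ρ).2 _ (hφ ρ₀).1))
  obtain ⟨ρ', hρ', hmin⟩ := (hlsc.lowerSemicontinuousOn _).exists_isMinOn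
    (boundaryMeasures_nonempty hN hne hΩ) (isCompact_boundaryMeasures hΩ)
  refine ⟨ρ', hρ', φ ρ', hφ ρ', fun ρ hρ ψ hψ => ?_⟩
  rw [hψ.eq hN (hφ ρ)]
  exact hmin hρ

end BornInfeld

end

theorem theorem3p1 (N : ℕ) (hN : 3 ≤ N) (Ω : Set (EuclideanSpace ℝ (Fin N)))
    (hΩ_open : IsOpen Ω) (hΩ_conn : IsConnected Ω) (hΩ_bdd : Bornology.IsBounded Ω) :
    (∀ ρ ∈ BornInfeld.boundaryMeasures Ω, ∃! φ, BornInfeld.IsPotential ρ φ) ∧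
    ∃ ρ', BornInfeld.IsEquilibriumMeasure Ω ρ' := by
  refine ⟨fun ρ _ => ?_, BornInfeld.exists_isEquilibriumMeasure hN hΩ_conn.nonempty hΩ_bdd⟩
  obtain ⟨φ, hφ⟩ := BornInfeld.exists_isPotential hN ρ
  exact ⟨φ, hφ, fun ψ hψ => hψ.eq hN hφ⟩
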